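/- **Conventions.** Let $\{0,1\}^*$ be the set of finite binary strings and $|s|$ the length of $s$. A *prefix-free machine* is a partial recursive function $F\colon\{0,1\}^*\to\{0,1\}^*$ whose domain $\operatorname{Dom}F$ is prefix-free (no element is a prefix of another element). A prefix-free machine $V$ is *optimal* if for every prefix-free machine $F$ there is $d\in\mathbb N$ such that for every $p\in\operatorname{Dom}F$ there is $q\in\operatorname{Dom}V$ with $V(q)=F(p)$ and $|q|\le|p|+d$. Fix an optimal prefix-free machine $U$ and let $H(s)=\min\{|p| : U(p)=s\}$. For a real $\alpha$ and $n\in\mathbb N$, let $\alpha{\restriction}n\in\{0,1\}^n$ be the first $n$ bits of the base-two expansion with infinitely many zeros of $\alpha-\lfloor\alpha\rfloor$, and let $\mathrm{Pf}(\alpha)=\{\alpha{\restriction}n : n\in\mathbb N\}$. A real $T$ is *computable* if there is a computable sequence $(a_n)_{n\in\mathbb N}$ of rationals with $|T-a_n|<2^{-n}$ for all $n$. A real is *r.e.* if it is the limit of a computable, strictly increasing sequence of rationals. A real $\alpha$ is *weakly Chaitin $T$-random* if there is $c\in\mathbb N$ such that $Tn-c\le H(\alpha{\restriction}n)$ for all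 $n\ge1$. For $f\colon\mathbb N\to\mathbb N$, a set $A\subseteq\{0,1\}^*$ is *reducible to* $B\subseteq\{0,1\}^*$ *in query size* $f$ if there is a deterministic oracle machine which, with oracle $B$, decides membership in $A$ and which on every input $x\in\{0,1\}^*$ only queries strings of length at most $f(|x|)$. **Theorem 4.2.** Let $T$ be a computable real with $0<T<1$, and let $V$ be an optimal prefix-free machine. Then there exists an r.e. real $\alpha\in(0,1)$ such that $\alpha$ is weakly Chaitin $T$-random and, for some $c\in\mathbb N$, $\mathrm{Pf}(\alpha)$ is reducible to $\operatorname{Dom}V$ in query size $f(n)=\lfloor Tn\rfloor+c$. -/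

import Mathlib

namespace AIT

/-- Finite binary strings. -/
abbrev Str := List Bool

/-! ### Computable sequences of rationals, computable reals, r.e. reals -/

/-- A sequence of rationals is computable if its signs, numerators and denominators are given
by total recursive functions. -/
def ComputableRatSeq (a : ℕ → ℚ) : Prop :=
  ∃ s p q : ℕ → ℕ, Computable s ∧ Computable p ∧ Computable q ∧
    ∀ n, q n ≠ 0 ∧ a n = (-1) ^ s n * (p n : ℚ) / (q n : ℚ)

/-- A real is computable if some computable sequence of rationals `a` satisfies
`|x - a n| < 2⁻ⁿ` for all `n`. -/
def IsComputableReal (x : ℝ) : Prop :=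
  ∃ a : ℕ → ℚ, ComputableRatSeq a ∧ ∀ n : ℕ, |x - (a n : ℝ)| < (2 : ℝ)⁻¹ ^ n

/-- A real is r.e. (left-computable) if it is the limit of a computable, (strictly) increasing
sequence of rationals. -/
def IsREReal (x : ℝ) : Prop :=
  ∃ a : ℕ → ℚ, ComputableRatSeq a ∧ StrictMono a ∧
    Filter.Tendsto (fun n => (a n : ℝ)) Filter.atTop (nhds x)

/-! ### Base-two expansions -/

/-- The first `n` bits of the base-two expansion with infinitely many zeros of the fractional
part of `x`. -/
noncomputable def realPrefix (x : ℝ) (n : ℕ) : Str :=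
  (List.range n).map fun i => decide (Real.digits (Int.fract x) 2 i = 1)

/-- The set of all finite prefixes of the base-two expansion of the fractional part of `x`. -/
def Pf (x : ℝ) : Set Str := Set.range (realPrefix x)

/-! ### Prefix-free machines and program-size complexity -/

/-- A set of strings is prefix-free if no element is a prefix of another element. -/
def PrefixFree (S : Set Str) : Prop :=
  ∀ p ∈ S, ∀ q ∈ S, p <+: q → p = q

/-- A prefix-free machine is a partial recursive function on strings with prefix-free domain. -/
def IsPrefixFreeMachine (F : Str →. Str) : Prop :=
  Partrec F ∧ PrefixFree F.Dom

/-- Optimal prefix-free machines. -/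
def IsOptimal (U : Str →. Str) : Prop :=
  IsPrefixFreeMachine U ∧
    ∀ F : Str →. Str, IsPrefixFreeMachine F →
      ∃ d : ℕ, ∀ p : Str, ∀ s ∈ F p, ∃ q : Str, s ∈ U q ∧ q.length ≤ p.length + d

/-- The complexity `H_F(s)`: the least length of a program `p` with `F p = s`
(`⊤` if there is none). -/
noncomputable def complexity (F : Str →. Str) (s : Str) : ℕ∞ :=
  ⨅ (p : Str) (_ : s ∈ F p), (p.length : ℕ∞)

/-- Weak Chaitin `T`-randomness, complexity being measured with the machine `U`:
for some `c`, `T n - c ≤ H_U(x↾n)` for all positive `n`. -/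
def WeaklyChaitinTRandom (U : Str →. Str) (T x : ℝ) : Prop :=
  ∃ c : ℕ, ∀ n : ℕ, 0 < n →
    ((T * n - c : ℝ) : EReal) ≤ ((complexity U (realPrefix x n) : ENNReal) : EReal)

/-! ### Oracle computation with a record of the queries -/

/-- Programs for deterministic oracle computation on natural numbers: the programs
`Nat.Partrec.Code` for partial recursive functions, with one more instruction `query`
consulting the oracle. -/
inductive OracleProgram : Type
  | zero : OracleProgram
  | succ : OracleProgram
  | left : OracleProgram
  | right : OracleProgram
  | query : OracleProgram
  | pair : OracleProgram → OracleProgram → OracleProgram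
  | comp : OracleProgram → OracleProgram → OracleProgram
  | prec : OracleProgram → OracleProgram → OracleProgram
  | rfind' : OracleProgram → OracleProgram

/-- `Run B M n v Q`: with the set of strings `B` as oracle, the program `M` halts on input `n`
with output `v`, and `Q` is the list of all strings about which the oracle has been asked in
the course of this computation, in order. Everything but `query` is as in
`Nat.Partrec.Code.eval`. The instruction `query` asks about the string encoded by its input
(an input that encodes no string results in no question and the output `0`). -/
inductive Run (B : Set Str) : OracleProgram → ℕ → ℕ → List Str → Prop
  | zero (n : ℕ) : Run B .zero n 0 []
  | succ (n : ℕ) : Run B .succ n (n + 1) []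
  | left (n : ℕ) : Run B .left n n.unpair.1 []
  | right (n : ℕ) : Run B .right n n.unpair.2 []
  | query_yes (n : ℕ) (q : Str) : Encodable.decode n = some q → q ∈ B → Run B .query n 1 [q]
  | query_no (n : ℕ) (q : Str) : Encodable.decode n = some q → q ∉ B → Run B .query n 0 [q]
  | query_none (n : ℕ) : Encodable.decode (α := Str) n = none → Run B .query n 0 []
  | pair {f g : OracleProgram} {n u v : ℕ} {Q R : List Str} :
      Run B f n u Q → Run B g n v R → Run B (.pair f g) n (Nat.pair u v) (Q ++ R)
  | comp {f g : OracleProgram} {n u v : ℕ} {Q R : List Str} :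
      Run B g n u Q → Run B f u v R → Run B (.comp f g) n v (Q ++ R)
  | prec_zero {f g : OracleProgram} {a v : ℕ} {Q : List Str} :
      Run B f a v Q → Run B (.prec f g) (Nat.pair a 0) v Q
  | prec_succ {f g : OracleProgram} {a k u v : ℕ} {Q R : List Str} :
      Run B (.prec f g) (Nat.pair a k) u Q → Run B g (Nat.pair a (Nat.pair k u)) v R →
        Run B (.prec f g) (Nat.pair a (k + 1)) v (Q ++ R)
  | rfind_stop {f : OracleProgram} {a k : ℕ} {Q : List Str} :
      Run B f (Nat.pair a k) 0 Q → Run B (.rfind' f) (Nat.pair a k) k Q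
  | rfind_next {f : OracleProgram} {a k u v : ℕ} {Q R : List Str} :
      Run B f (Nat.pair a k) (u + 1) Q → Run B (.rfind' f) (Nat.pair a (k + 1)) v R →
        Run B (.rfind' f) (Nat.pair a k) v (Q ++ R)

/-- `A` is reducible to `B` in query size `f`: a single oracle program with oracle `B` decides
membership in `A` (output `1` for yes and `0` for no), and on every input `x` it only queries
strings of length at most `f |x|`. -/
def ReducibleInQuerySize (A B : Set Str) (f : ℕ → ℕ) : Prop :=
  ∃ M : OracleProgram, ∀ x : Str, ∃ (v : ℕ) (Q : List Str),
    Run B M (Encodable.encode x) v Q ∧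
    (x ∈ A → v = 1) ∧ (x ∉ A → v = 0) ∧
    ∀ q ∈ Q, q.length ≤ f x.length

end AIT

namespace AIT

/-! Put `r = 2 ^ (-T)`, so `1/2 < r < 1`. Enumerate the halting computations of `U` without
repetition and let `α` be the sum of `2 ^ (-h i)`, where `h i` is about `|p| / T` for the `i`-th
program `p`, with small filler terms at idle stages. Since `r ^ h i` is about `2 ^ (-|p|)`, Kraft's
inequality makes `∑ r ^ h i` finite. This stronger convergence carries the upper bound on query
size.

Randomness (`weaklyChaitinTRandom_of_tendsto`): the first `n` bits of `α` reveal a stage after which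
no term with `h j < n` appears. All programs of length up to about `T n` have then halted, so a
string longer than all their outputs can be computed. A description of these bits thus yields a
string that is not the output of any program that short.

Reduction (`reducibleInQuerySize_of_tendsto`): call stage `i` a crossing at level `n` if it changes
the first `n` places of the partial sum. A term `2 ^ (-h)` contributes at most `2 * min 1 (2 ^ (n -
h))` to the number of crossings at level `n`. With weights `r ^ n` this sums over `n` to a constant
times `r ^ h`, as `2 * r > 1` and `r < 1`. The total weight of all crossings is therefore finite,
and the Kraft–Chaitin construction describes every crossing at level `n` with `T n + O(1)` bits
(`exists_crossing_machine`). By optimality `V` has such descriptions too. Asking which strings of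
that length are in the domain of `V`, and running those that are, bounds the last crossing, after
which the first `n` places are final. -/

/-! ### Binary strings as numbers, and prefixes of reals as floors -/

/-- The number with binary expansion `x`, most significant bit first. -/
def val (x : Str) : ℕ := x.foldl (fun a b => 2 * a + b.toNat) 0

lemma val_append_singleton (x : Str) (b : Bool) : val (x ++ [b]) = 2 * val x + b.toNat := by
  simp [val]

lemma val_append (x y : Str) : val (x ++ y) = val x * 2 ^ y.length + val y := by
  induction y using List.reverseRecOn with
  | nil => simp [val]
  | append_singleton y b ih =>
    rw [← List.append_assoc, val_append_singleton, val_append_singleton, ih]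
    simp only [List.length_append, List.length_singleton, pow_succ]
    ring

lemma val_lt (x : Str) : val x < 2 ^ x.length := by
  induction x using List.reverseRecOn with
  | nil => simp [val]
  | append_singleton y b ih =>
    rw [val_append_singleton, List.length_append, List.length_singleton, pow_succ]
    have := b.toNat_le
    omega

lemma val_injective {x y : Str} (hl : x.length = y.length) (h : val x = val y) : x = y := by
  induction x using List.reverseRecOn generalizing y with
  | nil => exact (List.length_eq_zero_iff.1 hl.symm).symm
  | append_singleton x a ih =>
    induction y using List.reverseRecOn with
    | nil => simp at hl
    | append_singleton y b _ =>
      rw [val_append_singleton, val_append_singleton] at h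
      have ha := a.toNat_le
      have hb := b.toNat_le
      have hab : a.toNat = b.toNat := by omega
      have hxy := ih (by simpa using hl) (y := y) (by omega)
      have : a = b := by revert hab; cases a <;> cases b <;> simp
      rw [hxy, this]

lemma exists_val_eq {l k : ℕ} (h : k < 2 ^ l) : ∃ x : Str, x.length = l ∧ val x = k := by
  induction l generalizing k with
  | zero => exact ⟨[], rfl, by simp at h; simp [val, h]⟩
  | succ l ih =>
    obtain ⟨x, hx, hv⟩ := ih (k := k / 2) (by rw [pow_succ] at h; omega)
    refine ⟨x ++ [decide (k % 2 = 1)], by simp [hx], ?_⟩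
    rw [val_append_singleton, hv]
    rcases Nat.mod_two_eq_zero_or_one k with h' | h' <;> simp [h'] <;> omega

lemma primrec_val : Primrec val := by
  refine Primrec.list_foldl (h := fun (_ : Str) (p : ℕ × Bool) => 2 * p.1 + p.2.toNat)
    Primrec.id (Primrec.const 0) ?_
  exact (Primrec.nat_add.comp
    (Primrec.nat_double.comp (Primrec.fst.comp Primrec.snd))
    ((Primrec.dom_bool Bool.toNat).comp (Primrec.snd.comp Primrec.snd)))

@[simp] lemma length_realPrefix (x : ℝ) (n : ℕ) : (realPrefix x n).length = n := by
  simp [realPrefix]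

lemma val_realPrefix (x : ℝ) (n : ℕ) : val (realPrefix x n) = ⌊2 ^ n * Int.fract x⌋₊ := by
  induction n with
  | zero =>
    simp only [realPrefix, List.range_zero, List.map_nil, val, List.foldl_nil, pow_zero, one_mul]
    exact (Nat.floor_eq_zero.2 (Int.fract_lt_one x)).symm
  | succ n ih =>
    have h1 : realPrefix x (n + 1) =
        realPrefix x n ++ [decide (Real.digits (Int.fract x) 2 n = 1)] := by
      simp [realPrefix, List.range_succ]
    rw [h1, val_append_singleton, ih, Real.digits]
    set y := Int.fract x
    have h2 : ⌊2 ^ n * y⌋₊ = ⌊2 ^ (n + 1) * y⌋₊ / 2 := by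
      rw [← Nat.floor_div_ofNat]
      congr 1
      rw [pow_succ]
      ring
    have h3 : ((2 : ℕ) : ℝ) = 2 := by norm_num
    rw [h2, h3, mul_comm y]
    set m := ⌊2 ^ (n + 1) * y⌋₊
    have h4 : (Fin.ofNat 2 m = 1) ↔ m % 2 = 1 := by
      rw [Fin.ext_iff]; simp
    have h5 : decide (Fin.ofNat 2 m = 1) = decide (m % 2 = 1) := decide_eq_decide.2 h4
    rw [h5]
    rcases Nat.mod_two_eq_zero_or_one m with h' | h' <;> simp [h'] <;> omega

/-- A string is determined by its length and value, so deciding prefixes amounts to computing one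
floor. -/
lemma mem_Pf_iff {a : ℝ} (h0 : 0 ≤ a) (h1 : a < 1) (x : Str) :
    x ∈ Pf a ↔ val x = ⌊2 ^ x.length * a⌋₊ := by
  have hf : Int.fract a = a := Int.fract_eq_self.2 ⟨h0, h1⟩
  constructor
  · rintro ⟨n, rfl⟩
    rw [val_realPrefix, length_realPrefix, hf]
  · intro h
    refine ⟨x.length, val_injective (by simp) ?_⟩
    rw [val_realPrefix, hf, h]

/-! ### Kraft's inequality -/

lemma PrefixFree.uniquelyDecodable {S : Set Str} (hS : PrefixFree S) (h0 : [] ∉ S) :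
    InformationTheory.UniquelyDecodable S := by
  intro L₁
  induction L₁ with
  | nil =>
    intro L₂ _ h2 h
    cases L₂ with
    | nil => rfl
    | cons w L =>
      simp only [List.flatten_nil, List.flatten_cons] at h
      have : w = [] := (List.append_eq_nil_iff.1 h.symm).1
      exact absurd (this ▸ h2 w (by simp)) h0
  | cons v K ih =>
    intro L₂ h1 h2 h
    cases L₂ with
    | nil =>
      simp only [List.flatten_nil, List.flatten_cons] at h
      have : v = [] := (List.append_eq_nil_iff.1 h).1
      exact absurd (this ▸ h1 v (by simp)) h0
    | cons w L =>
      simp only [List.flatten_cons] at h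
      have hvw : v = w := by
        rcases List.prefix_or_prefix_of_prefix (List.prefix_append v K.flatten)
          (h ▸ List.prefix_append w L.flatten) with h' | h'
        · exact hS _ (h1 v (by simp)) _ (h2 w (by simp)) h'
        · exact (hS _ (h2 w (by simp)) _ (h1 v (by simp)) h').symm
      subst hvw
      rw [ih L (fun w hw => h1 w (by simp [hw])) (fun w hw => h2 w (by simp [hw]))
        (List.append_cancel_left h)]

/-- Kraft's inequality for prefix-free sets. -/
lemma PrefixFree.kraft {S : Finset Str} (hS : PrefixFree (S : Set Str)) :
    ∑ w ∈ S, (1 / 2 : ℝ) ^ w.length ≤ 1 := by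
  -- The prefix-free set consisting of the empty word is not uniquely decodable, so it is treated
  -- apart from Kraft–McMillan.
  by_cases h0 : [] ∈ S
  · have : S = {[]} := by
      ext w
      constructor
      · intro hw
        rw [← hS [] h0 w hw List.nil_prefix]
        simp
      · intro hw
        rw [Finset.mem_singleton.1 hw]
        exact h0
    simp [this]
  · simpa using InformationTheory.kraft_mcmillan_inequality
      (hS.uniquelyDecodable (by simpa using h0))

/-! ### Exact computation of partial sums and their truncations -/

lemma computable_two_pow {α : Type*} [Primcodable α] {f : α → ℕ} (hf : Computable f) :
    Computable fun a => 2 ^ f a :=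
  ((Primrec₂.unpaired'.1 Nat.Primrec.pow).comp (Primrec.const 2) Primrec.id).to_comp.comp hf

lemma computable_le {α : Type*} [Primcodable α] {f g : α → ℕ} (hf : Computable f)
    (hg : Computable g) : Computable fun a => decide (f a ≤ g a) :=
  (Primrec.nat_le.decide.to_comp).comp hf hg

lemma computable_eq {α β : Type*} [Primcodable α] [Primcodable β] [DecidableEq β] {f g : α → β}
    (hf : Computable f) (hg : Computable g) : Computable fun a => decide (f a = g a) :=
  (Primrec.eq.decide.to_comp).comp hf hg

/-- Numerator and denominator of `∑ j < i, 2 ^ (-h j)`. -/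
def sumFrac (h : ℕ → ℕ) (i : ℕ) : ℕ × ℕ :=
  Nat.rec (0, 1) (fun j r => (r.1 * 2 ^ h j + r.2, r.2 * 2 ^ h j)) i

lemma computable_sumFrac {h : ℕ → ℕ} (hh : Computable h) : Computable (sumFrac h) := by
  refine Computable.nat_rec (f := fun i : ℕ => i) (g := fun _ => ((0, 1) : ℕ × ℕ))
    (h := fun _ (p : ℕ × ℕ × ℕ) => (p.2.1 * 2 ^ h p.1 + p.2.2, p.2.2 * 2 ^ h p.1))
    Computable.id (Computable.const _) ?_
  have hj : Computable fun p : ℕ × ℕ × ℕ × ℕ => 2 ^ h p.2.1 :=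
    computable_two_pow (hh.comp (Computable.fst.comp Computable.snd))
  have h1 : Computable fun p : ℕ × ℕ × ℕ × ℕ => p.2.2.1 :=
    Computable.fst.comp (Computable.snd.comp Computable.snd)
  have h2 : Computable fun p : ℕ × ℕ × ℕ × ℕ => p.2.2.2 :=
    Computable.snd.comp (Computable.snd.comp Computable.snd)
  exact (Primrec.nat_add.to_comp.comp (Primrec.nat_mul.to_comp.comp h1 hj) h2).pair
    (Primrec.nat_mul.to_comp.comp h2 hj)

/-- The partial sums `∑ j < i, 2 ^ (-h j)`. -/
noncomputable def psum (h : ℕ → ℕ) (i : ℕ) : ℝ := ∑ j ∈ Finset.range i, (1 / 2 : ℝ) ^ h j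

lemma psum_succ (h : ℕ → ℕ) (i : ℕ) : psum h (i + 1) = psum h i + (1 / 2) ^ h i :=
  Finset.sum_range_succ _ _

lemma psum_nonneg (h : ℕ → ℕ) (i : ℕ) : 0 ≤ psum h i :=
  Finset.sum_nonneg fun _ _ => by positivity

lemma psum_strictMono (h : ℕ → ℕ) : StrictMono (psum h) :=
  strictMono_nat_of_lt_succ fun i => by
    rw [psum_succ]
    have : (0 : ℝ) < (1 / 2) ^ h i := by positivity
    linarith

lemma sumFrac_snd_pos (h : ℕ → ℕ) (i : ℕ) : 0 < (sumFrac h i).2 := by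
  induction i with
  | zero => exact one_pos
  | succ i ih => exact Nat.mul_pos ih (by positivity)

lemma psum_eq (h : ℕ → ℕ) (i : ℕ) :
    psum h i = ((sumFrac h i).1 : ℝ) / ((sumFrac h i).2 : ℝ) := by
  induction i with
  | zero => simp [psum, sumFrac]
  | succ i ih =>
    have h1 : sumFrac h (i + 1) = ((sumFrac h i).1 * 2 ^ h i + (sumFrac h i).2,
      (sumFrac h i).2 * 2 ^ h i) := rfl
    have hpos : (0 : ℝ) < (sumFrac h i).2 := by exact_mod_cast sumFrac_snd_pos h i
    rw [psum_succ, ih, h1]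
    push_cast
    rw [one_div, inv_pow]
    field_simp

/-- `⌊2 ^ n * ∑ j < i, 2 ^ (-h j)⌋`. -/
def psumFloor (h : ℕ → ℕ) (n i : ℕ) : ℕ := 2 ^ n * (sumFrac h i).1 / (sumFrac h i).2

lemma psumFloor_eq (h : ℕ → ℕ) (n i : ℕ) : psumFloor h n i = ⌊2 ^ n * psum h i⌋₊ := by
  rw [psum_eq, psumFloor, ← Nat.floor_div_eq_div (K := ℝ)]
  push_cast
  rw [mul_div_assoc]

lemma computable_psumFloor {α : Type*} [Primcodable α] {h : ℕ → ℕ} (hh : Computable h)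
    {f g : α → ℕ} (hf : Computable f) (hg : Computable g) :
    Computable fun a => psumFloor h (f a) (g a) :=
  have hs := (computable_sumFrac hh).comp hg
  Primrec.nat_div.to_comp.comp
    (Primrec.nat_mul.to_comp.comp (computable_two_pow hf) (Computable.fst.comp hs))
    (Computable.snd.comp hs)

lemma isREReal_of_tendsto {h : ℕ → ℕ} (hh : Computable h) {x : ℝ}
    (hx : Filter.Tendsto (psum h) Filter.atTop (nhds x)) : IsREReal x := by
  have hcast : ∀ n, (((sumFrac h n).1 / (sumFrac h n).2 : ℚ) : ℝ) = psum h n := fun n => by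
    rw [psum_eq]; push_cast; rfl
  refine ⟨fun n => (sumFrac h n).1 / (sumFrac h n).2,
    ⟨fun _ => 0, fun n => (sumFrac h n).1, fun n => (sumFrac h n).2, Computable.const 0,
      Computable.fst.comp (computable_sumFrac hh), Computable.snd.comp (computable_sumFrac hh),
      fun n => ⟨(sumFrac_snd_pos h n).ne', by simp⟩⟩, fun i j hij => ?_, ?_⟩
  · have := psum_strictMono h hij
    rw [← hcast, ← hcast] at this
    exact_mod_cast this
  · simpa only [hcast] using hx

/-! ### The online Kraft–Chaitin machine -/

/-- The value of the code word of length `l i + 1` that the online form of the Kraft–Chaitin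
construction assigns to the `i`-th request: its dyadic interval lies between the `i`-th and the
`i + 1`-st partial sum of `2 ^ (-l j)`. -/
def codeVal (l : ℕ → ℕ) (i : ℕ) : ℕ := psumFloor l (l i + 1) i + 1

lemma psum_le_codeVal (l : ℕ → ℕ) (i : ℕ) :
    psum l i ≤ (codeVal l i : ℝ) / 2 ^ (l i + 1) := by
  rw [le_div_iff₀ (by positivity), codeVal, psumFloor_eq]
  push_cast
  rw [mul_comm]
  exact (Nat.lt_floor_add_one _).le

/-- The step `2 ^ (-l i)` is two grid cells wide, so the cell starting at the first grid point
beyond `psum l i` still fits. This is what the extra bit of code length buys. -/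
lemma codeVal_le_psum (l : ℕ → ℕ) (i : ℕ) :
    ((codeVal l i : ℝ) + 1) / 2 ^ (l i + 1) ≤ psum l (i + 1) := by
  rw [div_le_iff₀ (by positivity), codeVal, psumFloor_eq, psum_succ]
  have h1 := Nat.floor_le (a := 2 ^ (l i + 1) * psum l i)
    (mul_nonneg (by positivity) (psum_nonneg l i))
  have h2 : (1 / 2 : ℝ) ^ l i * 2 ^ (l i + 1) = 2 := by
    rw [pow_succ, ← mul_assoc, ← mul_pow]; norm_num
  push_cast
  rw [add_mul, h2]
  linarith

/-- The online Kraft–Chaitin machine with code lengths `l i + 1` and outputs `1 ^ f i`. -/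
def kraftMachine (l f : ℕ → ℕ) : Str →. Str := fun p =>
  (Nat.rfind fun i => Part.some (decide ((p.length, val p) = (l i + 1, codeVal l i)))).map
    fun i => List.replicate (f i) true

lemma computable_replicate {α : Type*} [Primcodable α] {f : α → ℕ} (hf : Computable f) :
    Computable fun a => List.replicate (f a) true := by
  have : Primrec fun n : ℕ => List.replicate n true :=
    (Primrec.list_map Primrec.list_range ((Primrec.const true).to₂)).of_eq fun n => by
      simp [List.map_const']
  exact this.to_comp.comp hf

lemma partrec_kraftMachine {l f : ℕ → ℕ} (hl : Computable l) (hf : Computable f) :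
    Partrec (kraftMachine l f) := by
  refine Partrec.map (Partrec.rfind ?_) ((computable_replicate (hf.comp Computable.snd)).to₂)
  have h1 : Computable fun a : Str × ℕ => (a.1.length, val a.1) :=
    (Computable.list_length.comp Computable.fst).pair (primrec_val.to_comp.comp Computable.fst)
  have hl2 : Computable fun a : Str × ℕ => l a.2 + 1 :=
    Computable.succ.comp (hl.comp Computable.snd)
  have h2 : Computable fun a : Str × ℕ => (l a.2 + 1, codeVal l a.2) :=
    hl2.pair (Computable.succ.comp (computable_psumFloor hl hl2 Computable.snd))
  exact (computable_eq h1 h2).partrec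

lemma mem_kraftMachine_dom {l f : ℕ → ℕ} {p : Str} (hp : p ∈ (kraftMachine l f).Dom) :
    ∃ i, p.length = l i + 1 ∧ val p = codeVal l i := by
  obtain ⟨i, hi⟩ := Part.dom_iff_mem.1 (show (Nat.rfind _).Dom from hp)
  have := (Nat.mem_rfind.1 hi).1
  simp only [Part.mem_some_iff] at this
  exact ⟨i, by simpa using this.symm⟩

/-- Extending a word nests its dyadic interval, whereas intervals of different requests are
separated by a partial sum. -/
lemma prefixFree_kraftMachine (l f : ℕ → ℕ) : PrefixFree (kraftMachine l f).Dom := by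
  intro p hp q hq hpq
  obtain ⟨i, hi, hi'⟩ := mem_kraftMachine_dom hp
  obtain ⟨j, hj, hj'⟩ := mem_kraftMachine_dom hq
  obtain ⟨r, rfl⟩ := hpq
  have hv := val_append p r
  have hr := val_lt r
  have hlen : l j + 1 = l i + 1 + r.length := by rw [← hi, ← hj, List.length_append]
  have e1 := psum_le_codeVal l i
  have e2 := codeVal_le_psum l i
  have e3 := psum_le_codeVal l j
  have e4 := codeVal_le_psum l j
  rw [hj', hi'] at hv
  have a1 : (codeVal l i : ℝ) / 2 ^ (l i + 1) ≤ codeVal l j / 2 ^ (l j + 1) := by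
    rw [hlen, pow_add _ (l i + 1) r.length, div_le_div_iff₀ (by positivity) (by positivity), hv]
    push_cast
    nlinarith [show (0 : ℝ) ≤ val r * 2 ^ (l i + 1) by positivity]
  have a2 : ((codeVal l j : ℝ) + 1) / 2 ^ (l j + 1) ≤ (codeVal l i + 1) / 2 ^ (l i + 1) := by
    have hr' : (val r : ℝ) + 1 ≤ 2 ^ r.length := by exact_mod_cast hr
    rw [hlen, pow_add _ (l i + 1) r.length, div_le_div_iff₀ (by positivity) (by positivity), hv]
    push_cast
    nlinarith [mul_le_mul_of_nonneg_right hr' (show (0 : ℝ) ≤ 2 ^ (l i + 1) by positivity)]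
  have a3 : (codeVal l j : ℝ) / 2 ^ (l j + 1) < (codeVal l j + 1) / 2 ^ (l j + 1) := by
    gcongr
    linarith
  rcases lt_trichotomy i j with hij | rfl | hij
  · have := (psum_strictMono l).monotone (show i + 1 ≤ j from hij)
    linarith
  · have : r = [] := List.length_eq_zero_iff.1 (by omega)
    simp [this]
  · have := (psum_strictMono l).monotone (show j + 1 ≤ i from hij)
    linarith

lemma isPrefixFreeMachine_kraftMachine {l f : ℕ → ℕ} (hl : Computable l) (hf : Computable f) :
    IsPrefixFreeMachine (kraftMachine l f) :=
  ⟨partrec_kraftMachine hl hf, prefixFree_kraftMachine l f⟩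

/-- The bound on the partial sums keeps the interval inside `[0, 1]`, so that its value has a binary
word of length `l i + 1`. -/
lemma exists_mem_kraftMachine {l f : ℕ → ℕ} (hs : ∀ k, psum l k ≤ 1) (i : ℕ) :
    ∃ p : Str, p.length = l i + 1 ∧ List.replicate (f i) true ∈ kraftMachine l f p := by
  have hlt : codeVal l i < 2 ^ (l i + 1) := by
    have h1 := (codeVal_le_psum l i).trans (hs (i + 1))
    rw [div_le_one (by positivity)] at h1
    have : codeVal l i + 1 ≤ 2 ^ (l i + 1) := by exact_mod_cast h1
    omega
  obtain ⟨p, hp, hv⟩ := exists_val_eq hlt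
  refine ⟨p, hp, ?_⟩
  obtain ⟨j, hj, -⟩ := Nat.rfind_min'
    (p := fun i => decide ((p.length, val p) = (l i + 1, codeVal l i))) (m := i) (by simp [hp, hv])
  have hj' : p.length = l j + 1 ∧ val p = codeVal l j := by
    have := (Nat.mem_rfind.1 hj).1
    simp only [PFun.coe_val, Part.mem_some_iff] at this
    simpa using this.symm
  -- The search might stop at an earlier request, but separated intervals cannot share a code word.
  have hij : i = j := by
    have a1 : (codeVal l i : ℝ) / 2 ^ (l i + 1) = codeVal l j / 2 ^ (l j + 1) := by
      rw [← hp, ← hv, hj'.2, hj'.1]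
    have a3 : ∀ k, (codeVal l k : ℝ) / 2 ^ (l k + 1) < (codeVal l k + 1) / 2 ^ (l k + 1) := by
      intro k
      gcongr
      linarith
    have b1 := psum_le_codeVal l i
    have b2 := codeVal_le_psum l i
    have b3 := psum_le_codeVal l j
    have b4 := codeVal_le_psum l j
    have c1 := a3 i
    have c2 := a3 j
    rcases lt_trichotomy i j with hij | rfl | hij
    · have := (psum_strictMono l).monotone (show i + 1 ≤ j from hij)
      linarith
    · rfl
    · have := (psum_strictMono l).monotone (show j + 1 ≤ i from hij)
      linarith
  subst hij
  exact Part.mem_map _ hj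

/-! ### Counting and describing crossings -/

/-- The step from the `i`-th to the `i + 1`-st partial sum changes the first `n` binary places. -/
def Crosses (h : ℕ → ℕ) (n i : ℕ) : Prop := psumFloor h n (i + 1) ≠ psumFloor h n i

instance (h : ℕ → ℕ) (n i : ℕ) : Decidable (Crosses h n i) :=
  inferInstanceAs (Decidable (_ ≠ _))

/-- Potential argument: the induction carries the number of crossings plus the fractional part of `2
^ n * psum h I`. A step of scaled size at least 1 raises this by at most 2; a smaller step raises it
by at most its own size, since a crossing then pays for itself by lowering the fractional part. -/
lemma crossings_le (h : ℕ → ℕ) (n I : ℕ) :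
    (∑ i ∈ Finset.range I, if Crosses h n i then (1 : ℝ) else 0) ≤
      ∑ j ∈ Finset.range I, 2 * min 1 (2 ^ n * (1 / 2) ^ h j) := by
  suffices H : (∑ i ∈ Finset.range I, if Crosses h n i then (1 : ℝ) else 0) +
      (2 ^ n * psum h I - psumFloor h n I) ≤
      ∑ j ∈ Finset.range I, 2 * min 1 (2 ^ n * (1 / 2) ^ h j) by
    have := Nat.floor_le (a := 2 ^ n * psum h I) (mul_nonneg (by positivity) (psum_nonneg h I))
    rw [← psumFloor_eq] at this
    linarith
  induction I with
  | zero => simp [psum, psumFloor, sumFrac]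
  | succ I ih =>
    rw [Finset.sum_range_succ, Finset.sum_range_succ]
    have f1 := Nat.floor_le (a := 2 ^ n * psum h I) (mul_nonneg (by positivity) (psum_nonneg h I))
    have f2 := Nat.lt_floor_add_one (2 ^ n * psum h (I + 1))
    have f3 : psumFloor h n I ≤ psumFloor h n (I + 1) := by
      rw [psumFloor_eq, psumFloor_eq]
      have := psum_strictMono h (Nat.lt_succ_self I)
      gcongr
    rw [← psumFloor_eq] at f1 f2
    have e : 2 ^ n * psum h (I + 1) = 2 ^ n * psum h I + 2 ^ n * (1 / 2) ^ h I := by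
      rw [psum_succ]; ring
    have hd : (0 : ℝ) < 2 ^ n * (1 / 2) ^ h I := by positivity
    rw [e] at f2 ⊢
    set d : ℝ := 2 ^ n * (1 / 2) ^ h I
    by_cases hc : Crosses h n I
    · rw [if_pos hc]
      rcases le_total 1 d with h1 | h1
      · rw [min_eq_left h1]
        linarith
      · rw [min_eq_right h1]
        have : psumFloor h n I + 1 ≤ psumFloor h n (I + 1) :=
          lt_of_le_of_ne f3 (Ne.symm hc)
        have : (psumFloor h n I : ℝ) + 1 ≤ psumFloor h n (I + 1) := by exact_mod_cast this
        linarith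
    · rw [if_neg hc]
      have : psumFloor h n (I + 1) = psumFloor h n I := not_not.1 hc
      rw [this] at f2 ⊢
      rw [min_eq_right (by linarith)]
      linarith

/-- Below `n = h` the terms grow with ratio `2 * r > 1`, and from there on they are at most `r ^ n`.
Both geometric series are of the order of their value at `n = h`. -/
lemma sum_geom_min_le {r : ℝ} (hr : 1 / 2 < r) (hr1 : r < 1) (h N : ℕ) :
    ∑ n ∈ Finset.range N, r ^ n * min 1 (2 ^ n * (1 / 2) ^ h) ≤
      (1 / (2 * r - 1) + 1 / (1 - r)) * r ^ h := by
  have hr0 : 0 < r := by linarith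
  have p1 : 0 < 2 * r - 1 := by linarith
  have p2 : 0 < 1 - r := by linarith
  have small : ∀ N ≤ h, ∑ n ∈ Finset.range N, r ^ n * min 1 (2 ^ n * (1 / 2) ^ h) ≤
      (2 * r) ^ N * (1 / 2) ^ h / (2 * r - 1) := by
    intro N
    induction N with
    | zero => intro _; simp; positivity
    | succ N ih =>
      intro hN
      rw [Finset.sum_range_succ]
      have h1 : r ^ N * min 1 (2 ^ N * (1 / 2) ^ h) ≤ (2 * r) ^ N * (1 / 2) ^ h := by
        calc _ ≤ r ^ N * (2 ^ N * (1 / 2) ^ h) :=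
              mul_le_mul_of_nonneg_left (min_le_right _ _) (by positivity)
          _ = _ := by rw [mul_pow]; ring
      have h2 := ih (by omega)
      rw [le_div_iff₀ p1] at h2 ⊢
      rw [pow_succ]
      nlinarith
  have large : ∀ k, ∑ n ∈ Finset.range (h + k), r ^ n * min 1 (2 ^ n * (1 / 2) ^ h) ≤
      r ^ h / (2 * r - 1) + (r ^ h - r ^ (h + k)) / (1 - r) := by
    intro k
    induction k with
    | zero =>
      refine (small h le_rfl).trans (le_of_eq ?_)
      rw [← mul_pow]
      simp [mul_comm]
    | succ k ih =>
      rw [← add_assoc, Finset.sum_range_succ]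
      have h1 : r ^ (h + k) * min 1 (2 ^ (h + k) * (1 / 2) ^ h) ≤ r ^ (h + k) :=
        mul_le_of_le_one_right (by positivity) (min_le_left _ _)
      have h2 : (r ^ h - r ^ (h + k + 1)) / (1 - r) =
          (r ^ h - r ^ (h + k)) / (1 - r) + r ^ (h + k) := by
        field_simp
        ring
      rw [h2]
      linarith
  calc _ ≤ ∑ n ∈ Finset.range (h + N), r ^ n * min 1 (2 ^ n * (1 / 2) ^ h) :=
        Finset.sum_le_sum_of_subset_of_nonneg
          (Finset.range_subset_range.2 (by omega)) fun _ _ _ => by positivity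
    _ ≤ r ^ h / (2 * r - 1) + (r ^ h - r ^ (h + N)) / (1 - r) := large N
    _ ≤ r ^ h / (2 * r - 1) + r ^ h / (1 - r) := by
        gcongr
        have : 0 < r ^ (h + N) := by positivity
        linarith
    _ = _ := by ring

lemma exists_weighted_crossings_le {r : ℝ} (hr : 1 / 2 < r) (hr1 : r < 1) {h : ℕ → ℕ}
    (hs : Summable fun i => r ^ h i) :
    ∃ B, ∀ N, ∑ n ∈ Finset.range N, ∑ i ∈ Finset.range N,
      (if Crosses h n i then r ^ n else 0) ≤ B := by
  have hr0 : 0 < r := by linarith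
  set K := 1 / (2 * r - 1) + 1 / (1 - r)
  have hK : 0 ≤ K := add_nonneg (div_nonneg zero_le_one (by linarith))
    (div_nonneg zero_le_one (by linarith))
  refine ⟨2 * (K * ∑' i, r ^ h i), fun N => ?_⟩
  calc _ = ∑ n ∈ Finset.range N, r ^ n *
        ∑ i ∈ Finset.range N, (if Crosses h n i then (1 : ℝ) else 0) := by
        refine Finset.sum_congr rfl fun n _ => ?_
        rw [Finset.mul_sum]
        exact Finset.sum_congr rfl fun i _ => by split_ifs <;> simp
    _ ≤ ∑ n ∈ Finset.range N, r ^ n *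
        ∑ j ∈ Finset.range N, 2 * min 1 (2 ^ n * (1 / 2) ^ h j) := by
        exact Finset.sum_le_sum fun n _ =>
          mul_le_mul_of_nonneg_left (crossings_le h n N) (by positivity)
    _ = 2 * ∑ j ∈ Finset.range N, ∑ n ∈ Finset.range N,
        r ^ n * min 1 (2 ^ n * (1 / 2) ^ h j) := by
        simp_rw [Finset.mul_sum]
        rw [Finset.sum_comm]
        exact Finset.sum_congr rfl fun _ _ => Finset.sum_congr rfl fun _ _ => by ring
    _ ≤ 2 * ∑ j ∈ Finset.range N, K * r ^ h j := by
        gcongr with j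
        exact sum_geom_min_le hr hr1 (h j) N
    _ ≤ _ := by
        rw [← Finset.mul_sum]
        gcongr
        exact hs.sum_le_tsum _ fun _ _ => by positivity

lemma sum_range_unpair_le {f : ℕ → ℕ → ℝ} (hf : ∀ n i, 0 ≤ f n i) (N : ℕ) :
    ∑ j ∈ Finset.range N, f j.unpair.1 j.unpair.2 ≤
      ∑ n ∈ Finset.range N, ∑ i ∈ Finset.range N, f n i := by
  have hinj : Set.InjOn Nat.unpair (Finset.range N : Set ℕ) :=
    Nat.pairEquiv.symm.injective.injOn
  rw [← Finset.sum_product', ← Finset.sum_image (f := fun p : ℕ × ℕ => f p.1 p.2) hinj]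
  refine Finset.sum_le_sum_of_subset_of_nonneg (fun p hp => ?_) fun _ _ _ => hf _ _
  obtain ⟨j, hj, rfl⟩ := Finset.mem_image.1 hp
  have := Finset.mem_range.1 hj
  exact Finset.mem_product.2 ⟨Finset.mem_range.2 ((Nat.unpair_left_le j).trans_lt this),
    Finset.mem_range.2 ((Nat.unpair_right_le j).trans_lt this)⟩

lemma exists_half_pow_mul_le (B : ℝ) : ∃ c : ℕ, (1 / 2 : ℝ) ^ c * B < 1 := by
  obtain ⟨c, hc⟩ := exists_pow_lt_of_lt_one (show 0 < 1 / (|B| + 1) by positivity)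
    (show (1 / 2 : ℝ) < 1 by norm_num)
  refine ⟨c, ?_⟩
  rw [lt_div_iff₀ (by positivity)] at hc
  have : (1 / 2 : ℝ) ^ c * B ≤ (1 / 2) ^ c * (|B| + 1) := by
    gcongr
    linarith [le_abs_self B]
  linarith

/-- A prefix-free machine describing with about `t n` bits, for every crossing at level `n`,
a bound on the stage where it happens. -/
lemma exists_crossing_machine {r A : ℝ} (hr : 1 / 2 < r) (hr1 : r < 1) {h t : ℕ → ℕ}
    (hh : Computable h) (ht : Computable t) (hs : Summable fun i => r ^ h i)
    (htr : ∀ n, (1 / 2 : ℝ) ^ t n ≤ A * r ^ n) :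
    ∃ F : Str →. Str, IsPrefixFreeMachine F ∧ ∃ c : ℕ, ∀ n i, Crosses h n i →
      ∃ p : Str, p.length ≤ t n + c ∧ List.replicate (i + 1) true ∈ F p := by
  obtain ⟨B, hB⟩ := exists_weighted_crossings_le hr hr1 hs
  -- The 2 pays for the filler requests, `A * B` for the crossings.
  obtain ⟨c, hc⟩ := exists_half_pow_mul_le (2 + A * B)
  have hr0 : 0 < r := by linarith
  have hA : 0 ≤ A := by
    have h0 : (0 : ℝ) < (1 / 2) ^ t 0 := by positivity
    have := htr 0
    simp only [pow_zero, mul_one] at this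
    linarith
  -- Request `j` codes a pair (level, stage). Pairs that are not crossings get a filler of length `j
  -- + c`, which keeps the request sequence total.
  let l : ℕ → ℕ := fun j =>
    (if Crosses h j.unpair.1 j.unpair.2 then t j.unpair.1 else j) + c
  have hl : Computable l := by
    have h1 : Computable fun j : ℕ => j.unpair.1 := Computable.fst.comp Computable.unpair
    have h2 : Computable fun j : ℕ => j.unpair.2 := Computable.snd.comp Computable.unpair
    have hdec : Computable fun j : ℕ => decide (psumFloor h j.unpair.1 (j.unpair.2 + 1) =
        psumFloor h j.unpair.1 j.unpair.2) :=
      computable_eq (computable_psumFloor hh h1 (Computable.succ.comp h2))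
        (computable_psumFloor hh h1 h2)
    refine (Primrec.nat_add.to_comp.comp
      (Computable.cond hdec Computable.id (ht.comp h1)) (Computable.const c)).of_eq fun j => ?_
    by_cases hj : psumFloor h j.unpair.1 (j.unpair.2 + 1) = psumFloor h j.unpair.1 j.unpair.2
    · simp [l, Crosses, hj]
    · simp [l, Crosses, hj]
  have hpl : ∀ k, psum l k ≤ 1 := by
    intro k
    refine le_trans ?_ hc.le
    calc psum l k ≤ ∑ j ∈ Finset.range k, (1 / 2 : ℝ) ^ c * ((1 / 2) ^ j +
          A * if Crosses h j.unpair.1 j.unpair.2 then r ^ j.unpair.1 else 0) := by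
          refine Finset.sum_le_sum fun j _ => ?_
          simp only [l]
          rw [pow_add, mul_comm]
          gcongr
          split_ifs with hj
          · have : (0 : ℝ) < (1 / 2) ^ j := by positivity
            linarith [htr j.unpair.1]
          · simp
      _ = (1 / 2 : ℝ) ^ c * (∑ j ∈ Finset.range k, (1 / 2 : ℝ) ^ j + A *
          ∑ j ∈ Finset.range k, if Crosses h j.unpair.1 j.unpair.2 then r ^ j.unpair.1 else 0) := by
          rw [← Finset.mul_sum, Finset.sum_add_distrib, Finset.mul_sum _ _ A]
      _ ≤ (1 / 2 : ℝ) ^ c * (2 + A * B) := by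
          gcongr
          · have := summable_geometric_two.sum_le_tsum (Finset.range k) fun _ _ => by positivity
            rwa [tsum_geometric_two] at this
          · exact (sum_range_unpair_le (f := fun n i => if Crosses h n i then r ^ n else 0)
              (fun n i => by positivity) k).trans (hB k)
  -- The output has length `i + 1`, so any bound on output lengths exceeds the stage `i` of the
  -- crossing.
  refine ⟨kraftMachine l fun j => j.unpair.2 + 1,
    isPrefixFreeMachine_kraftMachine hl
      (Computable.succ.comp (Computable.snd.comp Computable.unpair)), c + 1, fun n i hni => ?_⟩
  obtain ⟨p, hp, hm⟩ := exists_mem_kraftMachine (f := fun j => j.unpair.2 + 1) hpl (Nat.pair n i)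
  exact ⟨p, by simp [hp, l, hni, add_assoc], by simpa using hm⟩

/-! ### Enumerating the computations of a machine -/

/-- An enumeration without repetition of the graph of a partial recursive function. -/
lemma exists_enumeration {U : Str →. Str} (hU : Partrec U) :
    ∃ e : ℕ → Option (Str × Str), Computable e ∧
      (∀ p s, s ∈ U p → ∃ i, e i = some (p, s)) ∧
      (∀ i p s, e i = some (p, s) → s ∈ U p) ∧
      ∀ i j p s s', e i = some (p, s) → e j = some (p, s') → i = j := by
  obtain ⟨c, hc⟩ := Nat.Partrec.Code.exists_code.1 (Partrec.bind_decode₂_iff.1 hU)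
  let ev : ℕ → ℕ → Option ℕ := fun k a => Nat.Partrec.Code.evaln k c a
  have hev : ∀ {k a v}, ev k a = some v → ∃ p s, a = Encodable.encode p ∧
      v = Encodable.encode s ∧ s ∈ U p := by
    intro k a v h
    have h1 := Nat.Partrec.Code.evaln_sound h
    rw [hc] at h1
    simp only [Part.mem_bind_iff, Part.mem_ofOption, Part.mem_map_iff] at h1
    obtain ⟨p, hp, s, hs, rfl⟩ := h1
    exact ⟨p, s, (Encodable.mem_decode₂.1 hp).symm, rfl, hs⟩
  -- The index codes (program, time), and something is listed only if the computation succeeds with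
  -- bound `k + 1` but not with `k`. This happens once per halting program.
  let e : ℕ → Option (Str × Str) := fun i =>
    bif (ev i.unpair.2 i.unpair.1).isSome then none
    else (ev (i.unpair.2 + 1) i.unpair.1).bind fun v =>
      (Encodable.decode (α := Str) v).bind fun s =>
        (Encodable.decode (α := Str) i.unpair.1).map fun p => (p, s)
  have he : ∀ i p s, e i = some (p, s) ↔ ev i.unpair.2 i.unpair.1 = none ∧
      ev (i.unpair.2 + 1) i.unpair.1 = some (Encodable.encode s) ∧
      i.unpair.1 = Encodable.encode p := by
    intro i p s
    simp only [e]
    cases h1 : ev i.unpair.2 i.unpair.1 with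
    | some v => simp
    | none =>
      cases h2 : ev (i.unpair.2 + 1) i.unpair.1 with
      | none => simp
      | some v =>
        obtain ⟨p', s', ha, rfl, -⟩ := hev h2
        simp only [ha, Option.isSome_none, cond_false, Option.bind_some, Encodable.encodek,
          Option.map_some, Option.some.injEq, Prod.mk.injEq, true_and,
          Encodable.encode_injective.eq_iff]
        exact and_comm
  refine ⟨e, ?_, ?_, ?_, ?_⟩
  · have hp : Primrec fun i : ℕ => i.unpair.1 := Primrec.fst.comp Primrec.unpair
    have hk : Primrec fun i : ℕ => i.unpair.2 := Primrec.snd.comp Primrec.unpair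
    have hev' : ∀ {f : ℕ → ℕ}, Primrec f → Primrec fun i : ℕ => ev (f i) i.unpair.1 := fun hf =>
      Nat.Partrec.Code.primrec_evaln.comp ((hf.pair (Primrec.const c)).pair hp)
    refine Primrec.to_comp (Primrec.cond (Primrec.option_isSome.comp (hev' hk)) (Primrec.const none)
      (Primrec.option_bind (hev' (Primrec.succ.comp hk)) ?_))
    refine Primrec.option_bind (Primrec.decode.comp Primrec.snd) ?_
    refine Primrec.option_map (Primrec.decode.comp
      (hp.comp (Primrec.fst.comp Primrec.fst))) ?_
    exact (Primrec.snd.pair (Primrec.snd.comp Primrec.fst))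
  · intro p s hs
    have h1 : Encodable.encode s ∈ Nat.Partrec.Code.eval c (Encodable.encode p) := by
      rw [hc]
      simp only [Encodable.decode₂_encode, Part.coe_some, Part.bind_some, Part.mem_map_iff]
      exact ⟨s, hs, rfl⟩
    have h2 : ∃ k, ev k (Encodable.encode p) = some (Encodable.encode s) :=
      Nat.Partrec.Code.evaln_complete.1 h1
    have hf := Nat.find_spec h2
    have hm := fun m => Nat.find_min h2 (m := m)
    rcases hk : Nat.find h2 with _ | k
    · rw [hk] at hf
      simp [ev, Nat.Partrec.Code.evaln] at hf
    · rw [hk] at hf hm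
      refine ⟨Nat.pair (Encodable.encode p) k, (he _ _ _).2 ?_⟩
      simp only [Nat.unpair_pair, and_true]
      refine ⟨?_, hf⟩
      by_contra hne
      obtain ⟨v, hv⟩ := Option.ne_none_iff_exists'.1 hne
      have h3 : ev (k + 1) (Encodable.encode p) = some v :=
        Nat.Partrec.Code.evaln_mono k.le_succ hv
      rw [hf] at h3
      exact hm k k.lt_succ_self (hv.trans h3.symm)
  · intro i p s h
    obtain ⟨-, h2, h3⟩ := (he _ _ _).1 h
    obtain ⟨p', s', ha, hv, hs⟩ := hev h2
    rw [Encodable.encode_injective (h3.symm.trans ha), Encodable.encode_injective hv]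
    exact hs
  · intro i j p s s' hi hj
    obtain ⟨i1, i2, i3⟩ := (he _ _ _).1 hi
    obtain ⟨j1, j2, j3⟩ := (he _ _ _).1 hj
    have hmono : ∀ {k l a v}, ev k a = some v → ev l a = none → l < k := by
      intro k l a v hk hl
      by_contra! hle
      have : ev l a = some v := Nat.Partrec.Code.evaln_mono hle hk
      simp [hl] at this
    have hij : i.unpair.1 = j.unpair.1 := i3.trans j3.symm
    have k1 := hmono i2 (hij ▸ j1)
    have k2 := hmono j2 (hij ▸ i1)
    rw [← Nat.pair_unpair i, ← Nat.pair_unpair j, hij]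
    congr 1
    omega

/-- No program is listed twice, so the sum runs over distinct words of the prefix-free domain. -/
lemma sum_enumeration_le {U : Str →. Str} (hU : PrefixFree U.Dom)
    {e : ℕ → Option (Str × Str)} (he : ∀ i p s, e i = some (p, s) → s ∈ U p)
    (hinj : ∀ i j p s s', e i = some (p, s) → e j = some (p, s') → i = j) (N : ℕ) :
    ∑ i ∈ Finset.range N, ((e i).elim 0 fun x => (1 / 2 : ℝ) ^ x.1.length) ≤ 1 := by
  let f : ℕ → Str := fun i => ((e i).getD ([], [])).1
  let S := (Finset.range N).filter fun i => (e i).isSome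
  have hS : ∀ {i}, i ∈ S → ∃ s, e i = some (f i, s) := by
    intro i hi
    obtain ⟨x, hx⟩ := Option.isSome_iff_exists.1 (Finset.mem_filter.1 hi).2
    exact ⟨x.2, by simp [f, hx]⟩
  have hfi : Set.InjOn f S := by
    intro i hi j hj hij
    obtain ⟨s, hs⟩ := hS hi
    obtain ⟨s', hs'⟩ := hS hj
    exact hinj i j _ s s' hs (hij ▸ hs')
  have h1 : ∑ i ∈ Finset.range N, ((e i).elim 0 fun x => (1 / 2 : ℝ) ^ x.1.length) =
      ∑ w ∈ S.image f, (1 / 2 : ℝ) ^ w.length := by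
    rw [Finset.sum_image hfi, Finset.sum_filter]
    refine Finset.sum_congr rfl fun i _ => ?_
    cases h : e i <;> simp [f, h]
  rw [h1]
  refine PrefixFree.kraft fun p hp q hq => ?_
  have hdom : ∀ {w}, w ∈ (S.image f : Set Str) → w ∈ U.Dom := by
    intro w hw
    simp only [Finset.coe_image] at hw
    obtain ⟨i, hi, rfl⟩ := hw
    obtain ⟨s, hs⟩ := hS hi
    exact Part.dom_iff_mem.2 ⟨s, he _ _ _ hs⟩
  exact hU p (hdom hp) q (hdom hq)

/-! ### Integer approximations of multiplication and division by `T` -/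

/-- Multiples of a positive computable real are computable up to a bounded error. -/
lemma exists_computable_mul {T : ℝ} (hT : IsComputableReal T) (hT0 : 0 < T) :
    ∃ t : ℕ → ℕ, Computable t ∧ ∀ n, T * n - 2 ≤ t n ∧ t n ≤ T * n + 1 := by
  obtain ⟨a, ⟨s, p, q, -, hp, hq, ha⟩, hTa⟩ := hT
  refine ⟨fun n => p n * n / q n,
    Primrec.nat_div.to_comp.comp (Primrec.nat_mul.to_comp.comp hp Computable.id) hq, fun n => ?_⟩
  have hq0 : 0 < q n := Nat.pos_of_ne_zero (ha n).1
  have habs : |(a n : ℝ)| = (p n : ℝ) / q n := by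
    rw [(ha n).2]
    push_cast
    rw [abs_div, abs_mul, abs_pow, abs_neg, abs_one, one_pow, one_mul, Nat.abs_cast, Nat.abs_cast]
  have hclose : |T - (p n : ℝ) / q n| < (2 : ℝ)⁻¹ ^ n := by
    rw [← habs]
    refine lt_of_le_of_lt ?_ (hTa n)
    have := abs_abs_sub_abs_le T (a n)
    rwa [abs_of_pos hT0] at this
  -- The error `2 ^ (-n)` of the approximation stays below 1 after multiplication by `n`; rounding
  -- down costs at most one more.
  have hn : (n : ℝ) * (2 : ℝ)⁻¹ ^ n ≤ 1 := by
    rw [inv_pow, ← div_eq_mul_inv, div_le_one (by positivity)]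
    exact_mod_cast Nat.lt_two_pow_self.le
  have h1 := abs_lt.1 hclose
  have hfl : ((p n * n / q n : ℕ) : ℝ) = ⌊(p n : ℝ) / q n * n⌋₊ := by
    rw [← Nat.floor_div_eq_div (K := ℝ)]
    push_cast
    rw [mul_div_right_comm]
  have h2 := Nat.floor_le (a := (p n : ℝ) / q n * n) (by positivity)
  have h3 := Nat.lt_floor_add_one ((p n : ℝ) / q n * n)
  rw [← hfl] at h2 h3
  have hn0 : (0 : ℝ) ≤ n := n.cast_nonneg
  constructor <;> nlinarith

lemma exists_computable_inverse {t : ℕ → ℕ} (ht : Computable t) (hu : ∀ m, ∃ n, m ≤ t n) :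
    ∃ g : ℕ → ℕ, Computable g ∧ ∀ m, m ≤ t (g m) ∧ ∀ n, m ≤ t n → g m ≤ n := by
  classical
  refine ⟨fun m => Nat.find (hu m), ?_, fun m => ⟨Nat.find_spec (hu m),
    fun n hn => Nat.find_min' (hu m) hn⟩⟩
  have hp : Partrec fun m : ℕ => Nat.rfind fun n => Part.some (decide (m ≤ t n)) :=
    Partrec.rfind (computable_le Computable.fst (ht.comp Computable.snd)).partrec
  refine Partrec.of_eq_tot hp fun m => Nat.mem_rfind.2 ⟨?_, fun {n} hn => ?_⟩
  · simpa using Nat.find_spec (hu m)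
  · simpa using Nat.find_min (hu m) hn

/-! ### Weak randomness -/

lemma le_complexity {F : Str →. Str} {s : Str} {x : ℝ}
    (h : ∀ p, s ∈ F p → x ≤ p.length) :
    (x : EReal) ≤ ((complexity F s : ENNReal) : EReal) := by
  have h1 : (⌈x⌉₊ : ℕ∞) ≤ complexity F s :=
    le_iInf₂ fun p hp => by exact_mod_cast Nat.ceil_le.2 (h p hp)
  have h2 : ((⌈x⌉₊ : ℕ∞) : ENNReal) ≤ (complexity F s : ENNReal) := by exact_mod_cast h1
  calc (x : EReal) ≤ ((⌈x⌉₊ : ℝ) : EReal) := by exact_mod_cast Nat.le_ceil x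
    _ = (((⌈x⌉₊ : ℕ∞) : ENNReal) : EReal) := by
        rw [ENat.toENNReal_coe]; exact EReal.coe_coe_eq_natCast _
    _ ≤ _ := by exact_mod_cast h2

lemma psum_lt_of_tendsto {h : ℕ → ℕ} {a : ℝ}
    (ha : Filter.Tendsto (psum h) Filter.atTop (nhds a)) (i : ℕ) : psum h i < a :=
  ((psum_strictMono h) i.lt_succ_self).trans_le ((psum_strictMono h).monotone.ge_of_tendsto ha _)

/-- The sum of `2 ^ (-h i)` is weakly Chaitin `T`-random if the outputs of all programs of length
at most about `T n` are bounded by `o i` for a stage `i` where `h i` is at most about `n`. -/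
lemma weaklyChaitinTRandom_of_tendsto {U : Str →. Str} (hU : IsOptimal U) {T : ℝ}
    (hT0 : 0 < T) (hT1 : T < 1) {h o t : ℕ → ℕ} (hh : Computable h) (ho : Computable o)
    (ht : ∀ n, T * n - 2 ≤ t n) {c : ℕ}
    (hho : ∀ n p s, s ∈ U p → p.length ≤ t n → ∃ i, h i ≤ n + c ∧ s.length ≤ o i)
    {a : ℝ} (ha : Filter.Tendsto (psum h) Filter.atTop (nhds a)) (ha0 : 0 ≤ a) (ha1 : a < 1) :
    WeaklyChaitinTRandom U T a := by
  -- Starting at 1 makes `O i` strictly larger than every `o j` with `j < i`.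
  let O : ℕ → ℕ := fun i => Nat.rec 1 (fun j r => r + o j) i
  have hO : Computable O :=
    Computable.nat_rec Computable.id (Computable.const 1)
      (Primrec.nat_add.to_comp.comp (Computable.snd.comp Computable.snd)
        (ho.comp (Computable.fst.comp Computable.snd))).to₂
  have hOlt : ∀ i j, j < i → o j < O i := by
    intro i
    induction i with
    | zero => intro j hj; omega
    | succ i ih =>
      intro j hj
      have hs : O (i + 1) = O i + o i := rfl
      have h1 : 0 < O i := by
        clear ih hs hj
        induction i with
        | zero => exact one_pos
        | succ i ih => exact Nat.add_pos_left ih _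
      rcases Nat.lt_succ_iff_lt_or_eq.1 hj with hj' | rfl
      · have := ih j hj'
        omega
      · omega
  -- The slack `+ 1` guarantees that the search halts on prefixes of `a` even when `2 ^ n * a` is an
  -- integer that the partial sums never reach.
  let φ : Str →. Str := fun x =>
    (Nat.rfind fun i => Part.some (decide (val x ≤ psumFloor h x.length i + 1))).map
      fun i => List.replicate (O i) true
  have hφ : Partrec φ := by
    refine Partrec.map (Partrec.rfind ?_) ((computable_replicate (hO.comp Computable.snd)).to₂)
    exact (computable_le (primrec_val.to_comp.comp Computable.fst)
      (Computable.succ.comp (computable_psumFloor hh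
        (Computable.list_length.comp Computable.fst) Computable.snd))).partrec
  have hF : IsPrefixFreeMachine fun p => (U p).bind φ := by
    refine ⟨hU.1.1.bind (hφ.comp Computable.snd).to₂, fun p hp q hq hpq => ?_⟩
    have hdom : ∀ {p}, ((U p).bind φ).Dom → p ∈ U.Dom := fun h => Part.Dom.of_bind h
    exact hU.1.2 p (hdom hp) q (hdom hq) hpq
  obtain ⟨d, hd⟩ := hU.2 _ hF
  refine ⟨c + 3 + d, fun n hn => le_complexity fun p hp => ?_⟩
  have hfract : Int.fract a = a := Int.fract_eq_self.2 ⟨ha0, ha1⟩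
  have hval : val (realPrefix a n) = ⌊2 ^ n * a⌋₊ := by rw [val_realPrefix, hfract]
  have hv1 := Nat.floor_le (a := 2 ^ n * a) (by positivity)
  have hv2 := Nat.lt_floor_add_one (2 ^ n * a)
  rw [← hval] at hv1 hv2
  obtain ⟨i, hi⟩ : ∃ i, val (realPrefix a n) ≤ psumFloor h n i + 1 := by
    have hlim : Filter.Tendsto (fun i => 2 ^ n * psum h i) Filter.atTop (nhds (2 ^ n * a)) :=
      ha.const_mul _
    obtain ⟨i, hi⟩ := (hlim.eventually_const_lt
      (show (val (realPrefix a n) : ℝ) - 1 < 2 ^ n * a by linarith)).exists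
    refine ⟨i, ?_⟩
    have := Nat.lt_floor_add_one (2 ^ n * psum h i)
    rw [← psumFloor_eq] at this
    have : (val (realPrefix a n) : ℝ) < psumFloor h n i + 2 := by linarith
    have : val (realPrefix a n) < psumFloor h n i + 2 := by exact_mod_cast this
    omega
  obtain ⟨i, hi, -⟩ := Nat.rfind_min'
    (p := fun i => decide (val (realPrefix a n) ≤ psumFloor h (realPrefix a n).length i + 1))
    (m := i) (by simpa using hi)
  -- When the search stops, less than `2 * 2 ^ (-n)` of the sum is missing, whereas a term with `h j
  -- < n` is at least that large.
  have hstage : ∀ j, h j < n → j < i := by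
    intro j hj
    by_contra! hij
    have h1 := (Nat.mem_rfind.1 hi).1
    simp only [length_realPrefix, PFun.coe_val, Part.mem_some_iff] at h1
    have h1 := of_decide_eq_true h1.symm
    have h2 := Nat.floor_le (a := 2 ^ n * psum h i) (mul_nonneg (by positivity) (psum_nonneg h i))
    rw [← psumFloor_eq] at h2
    have h3 : (val (realPrefix a n) : ℝ) ≤ psumFloor h n i + 1 := by exact_mod_cast h1
    have h4 : psum h i + (1 / 2) ^ h j < a := by
      have := psum_lt_of_tendsto ha (j + 1)
      rw [psum_succ] at this
      have := (psum_strictMono h).monotone hij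
      linarith
    have h5 : (2 : ℝ) ≤ 2 ^ n * (1 / 2) ^ h j := by
      obtain ⟨k, rfl⟩ := Nat.exists_eq_add_of_lt hj
      rw [show (2 : ℝ) ^ (h j + k + 1) * (1 / 2) ^ h j = 2 * 2 ^ k * (2 ^ h j * (1 / 2) ^ h j) by
        ring, ← mul_pow]
      have : (1 : ℝ) ≤ 2 ^ k := one_le_pow₀ (by norm_num)
      norm_num
      linarith
    have h6 := mul_lt_mul_of_pos_left h4 (show (0 : ℝ) < 2 ^ n by positivity)
    rw [mul_add] at h6
    linarith
  have hmem : List.replicate (O i) true ∈ (U p).bind φ :=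
    Part.mem_bind hp (Part.mem_map _ hi)
  obtain ⟨q, hq, hql⟩ := hd p _ hmem
  have hql' : (q.length : ℝ) ≤ p.length + d := by exact_mod_cast hql
  push_cast
  rcases le_or_gt n c with hnc | hnc
  · have : (n : ℝ) ≤ c := by exact_mod_cast hnc
    have : T * n ≤ n := mul_le_of_le_one_left (by positivity) hT1.le
    have : (0 : ℝ) ≤ p.length := by positivity
    have : (0 : ℝ) ≤ d := by positivity
    linarith
  · obtain ⟨m, rfl⟩ := Nat.exists_eq_add_of_lt hnc
    -- Otherwise the output of `q` would be among those that `O i` exceeds in length.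
    have hlt : t m < q.length := by
      by_contra! hle
      obtain ⟨j, hj, hjs⟩ := hho m q _ hq hle
      have := hOlt i j (hstage j (by omega))
      rw [List.length_replicate] at hjs
      omega
    have h1 : (t m : ℝ) ≤ q.length := by exact_mod_cast hlt.le
    have h2 := ht m
    have h3 : T * (c + 1) ≤ c + 1 := mul_le_of_le_one_left (by positivity) hT1.le
    push_cast
    linarith

/-! ### Building oracle programs -/

/-- A program without oracle queries as an oracle program. -/
def OracleProgram.ofCode : Nat.Partrec.Code → OracleProgram
  | .zero => .zero
  | .succ => .succ
  | .left => .left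
  | .right => .right
  | .pair f g => .pair (ofCode f) (ofCode g)
  | .comp f g => .comp (ofCode f) (ofCode g)
  | .prec f g => .prec (ofCode f) (ofCode g)
  | .rfind' f => .rfind' (ofCode f)

lemma run_ofCode (B : Set Str) (c : Nat.Partrec.Code) {n v : ℕ} (h : v ∈ c.eval n) :
    Run B (.ofCode c) n v [] := by
  induction c generalizing n v with
  | zero => obtain rfl := Part.mem_some_iff.1 h; exact .zero n
  | succ => obtain rfl := Part.mem_some_iff.1 h; exact .succ n
  | left => obtain rfl := Part.mem_some_iff.1 h; exact .left n
  | right => obtain rfl := Part.mem_some_iff.1 h; exact .right n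
  | pair f g hf hg =>
    simp only [Nat.Partrec.Code.eval, Seq.seq, Part.map_eq_map, Part.mem_bind_iff,
      Part.mem_map_iff] at h
    obtain ⟨_, ⟨u, hu, rfl⟩, w, hw, rfl⟩ := h
    exact .pair (Q := []) (hf hu) (hg hw)
  | comp f g hf hg =>
    obtain ⟨u, hu, hv⟩ := Part.mem_bind_iff.1 h
    exact .comp (Q := []) (hg hu) (hf hv)
  | prec f g hf hg =>
    obtain ⟨a, k, rfl⟩ : ∃ a k, n = Nat.pair a k := ⟨_, _, (Nat.pair_unpair n).symm⟩
    induction k generalizing v with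
    | zero =>
      rw [Nat.Partrec.Code.eval_prec_zero] at h
      exact .prec_zero (hf h)
    | succ k ih =>
      rw [Nat.Partrec.Code.eval_prec_succ] at h
      obtain ⟨u, hu, hv⟩ := Part.mem_bind_iff.1 h
      exact .prec_succ (Q := []) (ih hu) (hg hv)
  | rfind' f hf =>
    obtain ⟨a, m, rfl⟩ : ∃ a k, n = Nat.pair a k := ⟨_, _, (Nat.pair_unpair n).symm⟩
    simp only [Nat.Partrec.Code.eval, Nat.unpaired, Nat.unpair_pair, Part.mem_map_iff] at h
    obtain ⟨r, hr, rfl⟩ := h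
    have hend := Nat.rfind_spec hr
    have hmin := fun k => Nat.rfind_min hr (m := k)
    clear hr
    simp only [Part.map_eq_map, Part.mem_map_iff, decide_eq_true_eq, decide_eq_false_iff_not]
      at hend hmin
    obtain ⟨_, hz, rfl⟩ := hend
    -- Induction on the number of rejected candidates, while the starting point `m` of the search
    -- moves up.
    induction r generalizing m with
    | zero =>
      rw [zero_add] at hz ⊢
      exact Run.rfind_stop (hf hz)
    | succ r ih =>
      obtain ⟨u, hu, hu0⟩ := hmin 0 r.succ_pos
      obtain ⟨u, rfl⟩ := Nat.exists_eq_succ_of_ne_zero hu0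
      rw [zero_add] at hu
      have e : ∀ k, k + 1 + m = k + (m + 1) := fun k => by omega
      rw [e] at hz ⊢
      refine .rfind_next (Q := []) (hf hu) (ih (m + 1) (fun k hk => ?_) hz)
      have := hmin (k + 1) (Nat.succ_lt_succ hk)
      rwa [e] at this

lemma exists_run_of_partrec {α σ : Type*} [Primcodable α] [Primcodable σ] {f : α →. σ}
    (hf : Partrec f) : ∃ M : OracleProgram, ∀ (B : Set Str) (a : α) (s : σ), s ∈ f a →
      Run B M (Encodable.encode a) (Encodable.encode s) [] := by
  obtain ⟨c, hc⟩ := Nat.Partrec.Code.exists_code.1 hf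
  refine ⟨.ofCode c, fun B a s hs => run_ofCode B c ?_⟩
  rw [hc]
  simp only [Encodable.encodek, Part.coe_some, Part.bind_some, Part.mem_map_iff]
  exact ⟨s, hs, rfl⟩

lemma exists_run_of_computable {α σ : Type*} [Primcodable α] [Primcodable σ] {f : α → σ}
    (hf : Computable f) : ∃ M : OracleProgram, ∀ (B : Set Str) (a : α),
      Run B M (Encodable.encode a) (Encodable.encode (f a)) [] := by
  obtain ⟨M, hM⟩ := exists_run_of_partrec hf.partrec
  exact ⟨M, fun B a => hM B a _ (Part.mem_some _)⟩

/-- The list of all strings of length at most `n`. -/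
def strings (n : ℕ) : List Str :=
  Nat.rec [[]] (fun _ l => [] :: (l.map (List.cons true) ++ l.map (List.cons false))) n

lemma mem_strings {n : ℕ} {q : Str} : q ∈ strings n ↔ q.length ≤ n := by
  induction n generalizing q with
  | zero => simp [strings]
  | succ n ih =>
    have h : strings (n + 1) = [] :: ((strings n).map (List.cons true) ++
      (strings n).map (List.cons false)) := rfl
    rw [h]
    cases q with
    | nil => simp
    | cons b q => cases b <;> simp [ih]

lemma primrec_strings : Primrec strings := by
  have hm : ∀ b : Bool, Primrec fun p : ℕ × List Str => p.2.map (List.cons b) := fun b =>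
    Primrec.list_map Primrec.snd (Primrec.list_cons.comp (Primrec.const b) Primrec.snd).to₂
  exact Primrec.nat_rec₁ (f := fun _ l => [] :: (l.map (List.cons true) ++ l.map (List.cons false)))
    _ (Primrec.list_cons.comp (Primrec.const _)
      (Primrec.list_append.comp (hm true) (hm false))).to₂

/-- With the domain of `V` as oracle, a bound on the lengths of the outputs of all programs for `V`
up to some length can be computed, with queries up to that length only, and used afterwards. -/
lemma exists_oracleProgram {V : Str →. Str} (hV : Partrec V) {L : ℕ → ℕ} (hL : Computable L)
    {φ : Str × ℕ → Bool} (hφ : Computable φ) :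
    ∃ M : OracleProgram, ∀ x : Str, ∃ (m : ℕ) (Q : List Str),
      Run V.Dom M (Encodable.encode x) (bif φ (x, m) then 1 else 0) Q ∧
      (∀ q ∈ Q, q.length ≤ L x.length) ∧
      ∀ q s, q.length ≤ L x.length → s ∈ V q → s.length ≤ m := by
  have hS : Computable fun x : Str => strings (L x.length) :=
    primrec_strings.to_comp.comp (hL.comp Computable.list_length)
  -- The default `[]` also respects the length bound. The last component, the accumulated bound, is
  -- ignored.
  let query : Str × ℕ × ℕ → Str := fun a => ((strings (L a.1.length))[a.2.1]?).getD []
  have hquery : Computable query :=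
    Computable.option_getD (Computable.list_getElem?.comp (hS.comp Computable.fst)
      (Computable.fst.comp Computable.snd)) (Computable.const [])
  have hlen : ∀ a, (query a).length ≤ L a.1.length := by
    intro a
    simp only [query]
    cases h : (strings (L a.1.length))[a.2.1]? with
    | none => simp
    | some q => exact mem_strings.1 (List.mem_of_getElem? h)
  -- `V` is run only after the oracle has confirmed halting, so the step always terminates. Adding
  -- up the output lengths gives an upper bound for each of them.
  let step : (Str × ℕ × ℕ) × ℕ →. ℕ := fun b =>
    bif decide (b.2 = 1) then (V (query b.1)).map fun s => b.1.2.2 + s.length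
    else Part.some b.1.2.2
  have hstep : Partrec step := by
    have hu : Computable fun b : (Str × ℕ × ℕ) × ℕ => b.1.2.2 :=
      Computable.snd.comp (Computable.snd.comp Computable.fst)
    refine Partrec.cond (computable_eq Computable.snd (Computable.const 1))
      (Partrec.map (hV.comp (hquery.comp Computable.fst)) ?_) hu.partrec
    exact (Primrec.nat_add.to_comp.comp (hu.comp Computable.fst)
      (Computable.list_length.comp Computable.snd)).to₂
  obtain ⟨Pq, hPq⟩ := exists_run_of_computable hquery
  obtain ⟨Ps, hPs⟩ := exists_run_of_partrec hstep
  obtain ⟨Pi, hPi⟩ := exists_run_of_computable (Computable.id (α := ℕ))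
  obtain ⟨Pn, hPn⟩ := exists_run_of_computable (Computable.list_length.comp hS)
  obtain ⟨Pf, hPf⟩ := exists_run_of_computable
    (Computable.cond hφ (Computable.const 1) (Computable.const 0))
  let loop : OracleProgram := .prec .zero (.comp Ps (.pair Pi (.comp .query Pq)))
  have hloop : ∀ (x : Str) (k : ℕ), ∃ (u : ℕ) (Q : List Str),
      Run V.Dom loop (Nat.pair (Encodable.encode x) k) u Q ∧
      (∀ q ∈ Q, q.length ≤ L x.length) ∧
      ∀ j < k, ∀ w, ∀ s ∈ V (query (x, j, w)), s.length ≤ u := by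
    intro x k
    induction k with
    | zero => exact ⟨0, [], .prec_zero (.zero _), by simp, by simp⟩
    | succ k ih =>
      obtain ⟨u, Q, hrun, hQ, hu⟩ := ih
      set a : Str × ℕ × ℕ := (x, k, u)
      have hcode : Nat.pair (Encodable.encode x) (Nat.pair k u) = Encodable.encode a := rfl
      obtain ⟨ans, v, hans, hv, hle, hbound⟩ : ∃ ans v : ℕ,
          Run V.Dom .query (Encodable.encode (query a)) ans [query a] ∧ v ∈ step (a, ans) ∧
          u ≤ v ∧ ∀ s ∈ V (query a), s.length ≤ v := by
        by_cases hd : query a ∈ V.Dom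
        · obtain ⟨s, hs⟩ := Part.dom_iff_mem.1 (show (V (query a)).Dom from hd)
          refine ⟨1, u + s.length, .query_yes _ _ (Encodable.encodek _) hd, ?_, by omega, ?_⟩
          · exact Part.mem_map _ hs
          · intro s' hs'
            rw [Part.mem_unique hs' hs]
            omega
        · refine ⟨0, u, .query_no _ _ (Encodable.encodek _) hd, Part.mem_some _, le_rfl, ?_⟩
          exact fun s hs => absurd (Part.dom_iff_mem.2 ⟨s, hs⟩) hd
      refine ⟨v, Q ++ [query a], ?_, ?_, ?_⟩
      · refine .prec_succ hrun ?_
        rw [hcode]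
        have h1 : Run V.Dom (.comp .query Pq) (Encodable.encode a) ans [query a] :=
          .comp (Q := []) (hPq _ a) hans
        have h2 : Run V.Dom (.pair Pi (.comp .query Pq)) (Encodable.encode a)
            (Nat.pair (Encodable.encode a) ans) [query a] :=
          .pair (Q := []) (hPi _ (Encodable.encode a)) h1
        exact .comp (R := []) h2 (hPs _ (a, ans) v hv)
      · intro q hq
        rcases List.mem_append.1 hq with hq | hq
        · exact hQ q hq
        · rw [List.mem_singleton.1 hq]
          exact hlen a
      · intro j hj w s hs
        rcases Nat.lt_succ_iff_lt_or_eq.1 hj with hj | rfl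
        · exact (hu j hj w s hs).trans hle
        · exact hbound s hs
  refine ⟨.comp Pf (.pair Pi (.comp loop (.pair Pi Pn))), fun x => ?_⟩
  obtain ⟨u, Q, hrun, hQ, hu⟩ := hloop x (strings (L x.length)).length
  refine ⟨u, Q, ?_, hQ, fun q s hq hs => ?_⟩
  · have h1 : Run V.Dom (.pair Pi Pn) (Encodable.encode x)
        (Nat.pair (Encodable.encode x) (strings (L x.length)).length) [] :=
      .pair (Q := []) (hPi _ (Encodable.encode x)) (hPn _ x)
    have h2 : Run V.Dom (.comp loop (.pair Pi Pn)) (Encodable.encode x) u Q :=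
      .comp (Q := []) h1 hrun
    have h3 : Run V.Dom (.pair Pi (.comp loop (.pair Pi Pn))) (Encodable.encode x)
        (Nat.pair (Encodable.encode x) u) Q :=
      .pair (Q := []) (hPi _ (Encodable.encode x)) h2
    have := Run.comp h3 (hPf _ (x, u))
    rwa [List.append_nil] at this
  · obtain ⟨j, hj, rfl⟩ := List.getElem_of_mem (mem_strings.2 hq)
    exact hu j hj 0 s (by simpa [query, hj] using hs)

/-! ### The reduction to the domain of `V` -/

lemma reducibleInQuerySize_of_computable {A : Set Str} {φ : Str → Bool} (hφ : Computable φ)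
    (hA : ∀ x, x ∈ A ↔ φ x = true) (B : Set Str) (f : ℕ → ℕ) : ReducibleInQuerySize A B f := by
  obtain ⟨M, hM⟩ := exists_run_of_computable
    (Computable.cond hφ (Computable.const 1) (Computable.const 0))
  exact ⟨M, fun x => ⟨_, [], hM B x, by simp +contextual [hA], by simp +contextual [hA], by simp⟩⟩

/-- After the last crossing the scaled partial sums stay below the next integer, but their limit
could equal it; `hint` excludes this. -/
lemma floor_eq_of_not_crosses {h : ℕ → ℕ} {a : ℝ}
    (ha : Filter.Tendsto (psum h) Filter.atTop (nhds a)) {n m : ℕ}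
    (hm : ∀ i, m ≤ i → ¬ Crosses h n i) (hint : ∀ k : ℕ, 2 ^ n * a ≠ k) :
    ⌊2 ^ n * a⌋₊ = psumFloor h n m := by
  have hconst : ∀ k, psumFloor h n (m + k) = psumFloor h n m := by
    intro k
    induction k with
    | zero => rfl
    | succ k ih => exact (not_not.1 (hm (m + k) (by omega))).trans ih
  have hlim : Filter.Tendsto (fun i => 2 ^ n * psum h i) Filter.atTop (nhds (2 ^ n * a)) :=
    ha.const_mul _
  have hle : 2 ^ n * a ≤ psumFloor h n m + 1 := by
    refine le_of_tendsto hlim (Filter.eventually_atTop.2 ⟨m, fun i hi => ?_⟩)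
    obtain ⟨k, rfl⟩ := Nat.exists_eq_add_of_le hi
    rw [← hconst k, psumFloor_eq]
    exact (Nat.lt_floor_add_one _).le
  have hge : (psumFloor h n m : ℝ) ≤ 2 ^ n * a := by
    rw [psumFloor_eq]
    refine (Nat.floor_le (mul_nonneg (by positivity) (psum_nonneg h m))).trans ?_
    have := (psum_lt_of_tendsto ha m).le
    gcongr
  refine (Nat.floor_eq_iff ((Nat.cast_nonneg _).trans hge)).2 ⟨hge, lt_of_le_of_ne hle ?_⟩
  exact_mod_cast hint (psumFloor h n m + 1)

/-- The case that `floor_eq_of_not_crosses` leaves out: all floors are then computable without an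
oracle. -/
lemma reducibleInQuerySize_of_dyadic {a : ℝ} (h0 : 0 ≤ a) (h1 : a < 1) {n k : ℕ}
    (hk : 2 ^ n * a = k) (B : Set Str) (f : ℕ → ℕ) : ReducibleInQuerySize (Pf a) B f := by
  have hφ : Computable fun x : Str => decide (val x = 2 ^ x.length * k / 2 ^ n) :=
    computable_eq primrec_val.to_comp (Primrec.nat_div.to_comp.comp
      (Primrec.nat_mul.to_comp.comp (computable_two_pow Computable.list_length)
        (Computable.const k)) (Computable.const _))
  refine reducibleInQuerySize_of_computable hφ (fun x => ?_) B f
  rw [mem_Pf_iff h0 h1, decide_eq_true_eq, ← Nat.floor_div_eq_div (K := ℝ)]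
  push_cast
  rw [← hk, mul_left_comm, mul_div_cancel_left₀ _ (by positivity)]

lemma reducibleInQuerySize_of_tendsto {V : Str →. Str} (hV : IsOptimal V) {r A : ℝ}
    (hr : 1 / 2 < r) (hr1 : r < 1) {h t : ℕ → ℕ} (hh : Computable h) (ht : Computable t)
    (hs : Summable fun i => r ^ h i) (htr : ∀ n, (1 / 2 : ℝ) ^ t n ≤ A * r ^ n) {a : ℝ}
    (ha : Filter.Tendsto (psum h) Filter.atTop (nhds a)) (ha0 : 0 ≤ a) (ha1 : a < 1) :
    ∃ c, ReducibleInQuerySize (Pf a) V.Dom fun n => t n + c := by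
  by_cases hdy : ∃ n k : ℕ, 2 ^ n * a = k
  · obtain ⟨n, k, hk⟩ := hdy
    exact ⟨0, reducibleInQuerySize_of_dyadic ha0 ha1 hk _ _⟩
  push Not at hdy
  obtain ⟨F, hF, c, hc⟩ := exists_crossing_machine hr hr1 hh ht hs htr
  obtain ⟨d, hd⟩ := hV.2 F hF
  have hL : Computable fun n => t n + (c + d) :=
    Primrec.nat_add.to_comp.comp ht (Computable.const _)
  have hφ : Computable fun y : Str × ℕ => decide (val y.1 = psumFloor h y.1.length y.2) :=
    computable_eq (primrec_val.to_comp.comp Computable.fst)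
      (computable_psumFloor hh (Computable.list_length.comp Computable.fst) Computable.snd)
  obtain ⟨M, hM⟩ := exists_oracleProgram hV.1.1 hL hφ
  refine ⟨c + d, M, fun x => ?_⟩
  obtain ⟨m, Q, hrun, hQ, hm⟩ := hM x
  -- A crossing at stage `i ≥ m` would give `V` a short program with output of length `i + 1 > m`,
  -- against the bound `m`.
  have hfl : ⌊2 ^ x.length * a⌋₊ = psumFloor h x.length m := by
    refine floor_eq_of_not_crosses ha (fun i hi hcr => ?_) (hdy _)
    obtain ⟨p, hp, hpF⟩ := hc _ _ hcr
    obtain ⟨q, hq, hql⟩ := hd p _ hpF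
    have := hm q _ (by omega) hq
    rw [List.length_replicate] at this
    omega
  refine ⟨_, Q, hrun, fun hx => ?_, fun hx => ?_, hQ⟩ <;>
    rw [mem_Pf_iff ha0 ha1, hfl] at hx <;> simp [hx]

lemma ReducibleInQuerySize.mono {A B : Set Str} {f f' : ℕ → ℕ} (h : ReducibleInQuerySize A B f)
    (hf : ∀ n, f n ≤ f' n) : ReducibleInQuerySize A B f' := by
  obtain ⟨M, hM⟩ := h
  refine ⟨M, fun x => ?_⟩
  obtain ⟨v, Q, h1, h2, h3, h4⟩ := hM x
  exact ⟨v, Q, h1, h2, h3, fun q hq => (h4 q hq).trans (hf _)⟩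

/-! ### Construction of the real -/

/-- Idle stages are dominated by a geometric series; the others, through `hg`, by the Kraft sum of
the listed programs. -/
lemma summable_enumeration_weights {U : Str →. Str} (hU : PrefixFree U.Dom)
    {e : ℕ → Option (Str × Str)} (he : ∀ i p s, e i = some (p, s) → s ∈ U p)
    (hinj : ∀ i j p s s', e i = some (p, s) → e j = some (p, s') → i = j)
    {r A : ℝ} (hr0 : 0 < r) (hr1 : r < 1) (hA : 0 ≤ A) {g : ℕ → ℕ}
    (hg : ∀ m, r ^ g m ≤ A * (1 / 2) ^ m) :
    Summable fun i => r ^ ((e i).elim i fun x => g x.1.length) := by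
  refine summable_of_sum_range_le (c := (1 - r)⁻¹ + A * 1) (fun i => by positivity) fun N => ?_
  calc _ ≤ ∑ i ∈ Finset.range N,
        (r ^ i + A * (e i).elim 0 fun x => (1 / 2 : ℝ) ^ x.1.length) := by
        refine Finset.sum_le_sum fun i _ => ?_
        have : 0 < r ^ i := by positivity
        cases h : e i with
        | none => simp
        | some x => simpa using (hg x.1.length).trans (by simpa using this.le)
    _ = ∑ i ∈ Finset.range N, r ^ i +
        A * ∑ i ∈ Finset.range N, (e i).elim 0 fun x => (1 / 2 : ℝ) ^ x.1.length := by
        rw [Finset.sum_add_distrib, Finset.mul_sum]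
    _ ≤ _ := by
        gcongr
        · rw [← tsum_geometric_of_lt_one hr0.le hr1]
          exact (summable_geometric_of_lt_one hr0.le hr1).sum_le_tsum _ fun _ _ => by positivity
        · exact sum_enumeration_le hU he hinj N

lemma rpow_neg_pow (T : ℝ) (n : ℕ) : ((2 : ℝ) ^ (-T)) ^ n = 2 ^ (-(T * n)) := by
  rw [← Real.rpow_natCast, ← Real.rpow_mul (by norm_num), neg_mul]

lemma half_pow_eq_rpow (n : ℕ) : (1 / 2 : ℝ) ^ n = 2 ^ (-(n : ℝ)) := by
  rw [Real.rpow_neg (by norm_num), Real.rpow_natCast, one_div, inv_pow]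

end AIT

theorem theorem4p2 (U : AIT.Str →. AIT.Str) (hU : AIT.IsOptimal U)
    (T : ℝ) (hT : AIT.IsComputableReal T) (hT0 : 0 < T) (hT1 : T < 1)
    (V : AIT.Str →. AIT.Str) (hV : AIT.IsOptimal V) :
    ∃ α : ℝ, 0 < α ∧ α < 1 ∧ AIT.IsREReal α ∧ AIT.WeaklyChaitinTRandom U T α ∧
      ∃ c : ℕ, AIT.ReducibleInQuerySize (AIT.Pf α) V.Dom
        (fun n : ℕ => ⌊T * (n : ℝ)⌋₊ + c) := by
  open AIT in
  obtain ⟨t, htc, ht⟩ := exists_computable_mul hT hT0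
  -- `g m` is about `m / T`. Its two properties serve opposite ends: `m ≤ t (g m)` gives
  -- convergence, minimality gives randomness.
  obtain ⟨g, hgc, hg⟩ := exists_computable_inverse htc fun m => by
    obtain ⟨n, hn⟩ := exists_nat_ge ((m + 2) / T)
    rw [div_le_iff₀' hT0] at hn
    exact ⟨n, by exact_mod_cast (show (m : ℝ) ≤ t n by linarith [(ht n).1])⟩
  obtain ⟨e, hec, he1, he2, he3⟩ := exists_enumeration hU.1.1
  set r : ℝ := 2 ^ (-T) with hr_def
  have hr : 1 / 2 < r := by
    have := Real.rpow_lt_rpow_of_exponent_lt (x := 2) (by norm_num) (neg_lt_neg hT1)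
    rwa [Real.rpow_neg_one, ← one_div] at this
  have hr1 : r < 1 := Real.rpow_lt_one_of_one_lt_of_neg (by norm_num) (by linarith)
  have hr0 : 0 < r := by linarith
  have htr : ∀ n, (1 / 2 : ℝ) ^ t n ≤ 2 ^ (2 : ℝ) * r ^ n := fun n => by
    rw [hr_def, rpow_neg_pow, half_pow_eq_rpow, ← Real.rpow_add (by norm_num)]
    exact Real.rpow_le_rpow_of_exponent_le (by norm_num) (by linarith [(ht n).1])
  have hgr : ∀ m, r ^ g m ≤ 2 ^ (1 : ℝ) * (1 / 2) ^ m := fun m => by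
    have : (m : ℝ) ≤ t (g m) := by exact_mod_cast (hg m).1
    rw [hr_def, rpow_neg_pow, half_pow_eq_rpow, ← Real.rpow_add (by norm_num)]
    exact Real.rpow_le_rpow_of_exponent_le (by norm_num) (by linarith [(ht (g m)).2])
  let h₀ : ℕ → ℕ := fun i => (e i).elim i fun x => g x.1.length
  have hs₀ : Summable fun i => r ^ h₀ i :=
    summable_enumeration_weights hU.1.2 he2 he3 hr0 hr1 (by positivity) hgr
  -- Shifting all exponents by `c` scales the sum into the unit interval.
  obtain ⟨c, hc⟩ := exists_half_pow_mul_le (∑' i, (1 / 2 : ℝ) ^ h₀ i)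
  let h : ℕ → ℕ := fun i => h₀ i + c
  let o : ℕ → ℕ := fun i => (e i).elim 0 fun x => x.2.length
  have hh₀ : Computable h₀ :=
    (Computable.option_casesOn hec Computable.id (hgc.comp (Computable.list_length.comp
      (Computable.fst.comp Computable.snd))).to₂).of_eq fun i => by cases hi : e i <;> simp [h₀, hi]
  have hh : Computable h := Primrec.nat_add.to_comp.comp hh₀ (Computable.const c)
  have ho : Computable o :=
    (Computable.option_casesOn hec (Computable.const 0) (Computable.list_length.comp
      (Computable.snd.comp Computable.snd)).to₂).of_eq fun i => by cases hi : e i <;> simp [o, hi]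
  have hs : Summable fun i => r ^ h i := by
    simpa only [h, pow_add] using hs₀.mul_right (r ^ c)
  have hsh : ∀ {k : ℕ → ℕ}, (Summable fun i => r ^ k i) → Summable fun i => (1 / 2 : ℝ) ^ k i :=
    fun hk => hk.of_nonneg_of_le (fun i => by positivity) fun i => by gcongr
  have ha : Filter.Tendsto (psum h) Filter.atTop (nhds (∑' i, (1 / 2 : ℝ) ^ h i)) :=
    (hsh hs).hasSum.tendsto_sum_nat
  have ha1 : ∑' i, (1 / 2 : ℝ) ^ h i < 1 := by
    simp only [h, pow_add]
    rwa [tsum_mul_right, mul_comm]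
  set a := ∑' i, (1 / 2 : ℝ) ^ h i
  have ha0 : 0 < a := (psum_nonneg h 0).trans_lt (psum_lt_of_tendsto ha 0)
  have hho : ∀ n p s, s ∈ U p → p.length ≤ t n → ∃ i, h i ≤ n + c ∧ s.length ≤ o i := by
    intro n p s hps hp
    obtain ⟨i, hi⟩ := he1 p s hps
    refine ⟨i, ?_, by simp [o, hi]⟩
    have := (hg p.length).2 n hp
    simpa [h, h₀, hi] using this
  obtain ⟨b, hb⟩ := reducibleInQuerySize_of_tendsto hV hr hr1 hh htc hs htr ha ha0.le ha1
  refine ⟨a, ha0, ha1, isREReal_of_tendsto hh ha,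
    weaklyChaitinTRandom_of_tendsto hU hT0 hT1 hh ho (fun n => (ht n).1) hho ha ha0.le ha1,
    1 + b, hb.mono fun n => ?_⟩
  -- Since `t n` may exceed `T * n` by up to 1, the constant grows from `b` to `1 + b`.
  have h1 : t n ≤ ⌊T * n + 1⌋₊ := Nat.le_floor (ht n).2
  rw [Nat.floor_add_one (by positivity)] at h1
  omega
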